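/- Notation. All fronts consist of finite subsets of $\omega$; $a\sqsubseteq b$ (resp. $a\sqsubset b$) means that $a$ is an initial segment (resp. a proper initial segment) of $b$. A set $B\subseteq[\omega]^{<\omega}$ is a *front* on $\omega$ if no member of $B$ is a proper initial segment of another one and every infinite $X\subseteq\omega$ has an initial segment in $B$. A front $B\neq\{\emptyset\}$ on $\omega$ is *flat-top* if either $B=[\omega]^1$, or every member of $B$ has at least two elements and for each $b\in B$, with $a=b\setminus\{\max b\}$, we have $\{c\setminus a: c\in B,\ a\sqsubset c\}=\{\{n\}:n>\max a\}$. Let $\hat B$ be the set of all initial segments of members of $B$ and $\hat B^-=\hat B\setminus B$. For an ultrafilter $\mathcal V$ on $\omega$, let $\mathfrak T=\mathfrak T(B,\mathcal V)$ be the set of all $T\subseteq\hat B$ which are closed under initial segments, contain $\emptyset$, and satisfy $\{n: c\cup\{n\}\in T\}\in\mathcal V$ for every $c\in T\cap\hat B^-$. Let $[T]$ be the set of maximal nodes of $T$ (for a front $B$ these represent the maximal branches of $T$). A nonprincipal ultrafilter $\mathcal V$ on $\omega$ is *selective* if every function on $\omega$ is constant or one-to-one on some set in $\mathcal V$. Two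 ultrafilters, on possibly different base sets, are isomorphic if some map that is one-to-one on a set in the first ultrafilter carries the first to the second. The *Fubini powers* of $\mathcal V$ form the least class of ultrafilters (on sets) that contains $\mathcal V$, is closed under isomorphism, and contains $\lim_{n\to\mathcal V}\mathcal W_n=\{A: \{n:\{x:(n,x)\in A\}\in\mathcal W_n\}\in\mathcal V\}$ whenever it contains all $\mathcal W_n$, $n<\omega$. (It contains all $\mathcal V^\alpha$, $1\le\alpha<\omega_1$, for all choices at limit stages.) A *flat-top front base* for a Fubini power $\mathcal U$ of $\mathcal V$ is a flat-top front $B$ such that $\mathcal U$ is isomorphic to the filter on $B$ generated by $\{[T]:T\in\mathfrak T(B,\mathcal V)\}$. Statement. Let $\mathcal U$ be a Fubini power of a selective ultrafilter $\mathcal V$. Then $\mathcal U$ has a flat-top front base. Moreover, for every flat-top front base $B$ for $\mathcal U$ there is a map $\tau:\hat B\to\omega$ whose restriction to $\hat B\setminus\{\emptyset\}$ is finite-to-one (hence so is its restriction to $B$) such that $\{\tau(T\setminus\{\emptyset\}):T\in\mathfrak T\}$ generates $\mathcal V$ and also $\{\tau([T]):T\in\mathfrak T\}$ generates $\mathcal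 V$; that is, for every $A\subseteq\omega$, $$A\in\mathcal V\iff \exists T\in\mathfrak T\ \ \tau(T\setminus\{\emptyset\})\subseteq A\iff \exists T\in\mathfrak T\ \ \tau([T])\subseteq A .$$ -/

import Mathlib

open Filter Set

namespace FubiniPower

/-! ### Initial segments and fronts -/

/-- `a ⊑ X`: `a` is an initial segment of the set `X` of natural numbers. -/
def IsInitSeg (a X : Set ℕ) : Prop :=
  a ⊆ X ∧ ∀ x ∈ X, ∀ y ∈ a, x ≤ y → x ∈ a

/-- `a ⊏ X`: `a` is a proper initial segment of `X`. -/
def IsProperInitSeg (a X : Set ℕ) : Prop :=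
  IsInitSeg a X ∧ a ≠ X

/-- `B` is a front on the set `I` of natural numbers. -/
structure IsFront (I : Set ℕ) (B : Set (Finset ℕ)) : Prop where
  subset_base : ∀ b ∈ B, (b : Set ℕ) ⊆ I
  antichain : ∀ a ∈ B, ∀ b ∈ B, ¬ IsProperInitSeg (a : Set ℕ) (b : Set ℕ)
  exists_initSeg : ∀ X : Set ℕ, X ⊆ I → X.Infinite → ∃ b ∈ B, IsProperInitSeg (b : Set ℕ) X

/-- `B` is a flat-top front (on the set of all natural numbers): a front different from `{∅}` such
that either `B = [ω]¹`, or all members of `B` have at least two elements and, for each `b ∈ B`,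
with `a = b \ {max b}`, the set `{c \ a : c ∈ B, a ⊏ c}` is the set of all singletons `{n}`
with `n > max a`.  (For a nonempty finite set `s` of naturals, `s.sup id` is its maximum.) -/
def IsFlatTopFront (B : Set (Finset ℕ)) : Prop :=
  IsFront Set.univ B ∧ B ≠ {∅} ∧
    (B = {b | b.card = 1} ∨
      ((∀ b ∈ B, 2 ≤ b.card) ∧
        ∀ b ∈ B, ∀ a : Finset ℕ, a = b \ {b.sup id} →
          {d : Finset ℕ | ∃ c ∈ B, IsProperInitSeg (a : Set ℕ) (c : Set ℕ) ∧ d = c \ a} =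
            {d : Finset ℕ | ∃ n : ℕ, a.sup id < n ∧ d = {n}}))

/-- `B̂`: the set of all initial segments of members of `B`. -/
def hat (B : Set (Finset ℕ)) : Set (Finset ℕ) :=
  {a | ∃ b ∈ B, IsInitSeg (a : Set ℕ) (b : Set ℕ)}

/-- `B̂⁻ = B̂ \ B`. -/
def hatMinus (B : Set (Finset ℕ)) : Set (Finset ℕ) :=
  hat B \ B

/-! ### Trees of ultrafilters -/

/-- `T` is a tree: it is closed under initial segments. -/
def IsTree (T : Set (Finset ℕ)) : Prop :=
  ∀ t ∈ T, ∀ s : Finset ℕ, IsInitSeg (s : Set ℕ) (t : Set ℕ) → s ∈ T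

/-- `T` is a tree for the family `(W c : c ∈ B̂⁻)` of ultrafilters on `ω`.  (Only the values of
`W` on `B̂⁻` matter.) -/
structure IsUTree (B : Set (Finset ℕ)) (W : Finset ℕ → Ultrafilter ℕ)
    (T : Set (Finset ℕ)) : Prop where
  subset_hat : T ⊆ hat B
  isTree : IsTree T
  empty_mem : ∅ ∈ T
  succ_mem : ∀ c ∈ T ∩ hatMinus B, {n : ℕ | c ∪ {n} ∈ T} ∈ W c

/-- `[T]`: the maximal nodes of `T`.  A tree inside `B̂`, for a front `B`, has no infinite branch,
so a maximal branch is determined by its last node. -/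
def maxBranches (T : Set (Finset ℕ)) : Set (Finset ℕ) :=
  {t | t ∈ T ∧ ∀ s ∈ T, IsInitSeg (t : Set ℕ) (s : Set ℕ) → s = t}

/-- The filter on the base set `B` generated by the sets `[T]`, for `T` a tree for the
family `W`. -/
def treeFilter (B : Set (Finset ℕ)) (W : Finset ℕ → Ultrafilter ℕ) : Filter B :=
  Filter.generate {A : Set B | ∃ T, IsUTree B W T ∧ A = {b : B | (b : Finset ℕ) ∈ maxBranches T}}

/-! ### Ultrafilters -/

/-- A selective (Ramsey) ultrafilter on `ω`: a nonprincipal ultrafilter such that every function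
on `ω` is constant or one-to-one on a set in the ultrafilter. -/
def IsSelective (V : Ultrafilter ℕ) : Prop :=
  (V : Filter ℕ) ≤ cofinite ∧
    ∀ f : ℕ → ℕ, ∃ A ∈ V, (∃ k, ∀ n ∈ A, f n = k) ∨ Set.InjOn f A

/-- Isomorphism of ultrafilters (on possibly different base sets): a map which is one-to-one on a
large set carries one to the other. -/
def Isomorphic {X Y : Type} (F : Filter X) (G : Filter Y) : Prop :=
  ∃ f : X → Y, (∃ A ∈ F, Set.InjOn f A) ∧ Filter.map f F = G

/-- The Fubini product `lim_{n → V} W n`, on the base set of pairs `(n, x)` with `x` in the base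
set of `W n`. -/
def fubiniLim (V : Ultrafilter ℕ) {X : ℕ → Type} (W : ∀ n, Ultrafilter (X n)) :
    Ultrafilter (Σ n, X n) :=
  Ultrafilter.bind V fun n => (W n).map (Sigma.mk n)

theorem mem_fubiniLim (V : Ultrafilter ℕ) {X : ℕ → Type} (W : ∀ n, Ultrafilter (X n))
    (A : Set (Σ n, X n)) :
    A ∈ fubiniLim V W ↔ {n | {x | (⟨n, x⟩ : Σ n, X n) ∈ A} ∈ W n} ∈ V :=
  Iff.rfl

/-- The Fubini powers of `V`: the least class of ultrafilters which contains `V`, contains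
`lim_{n → V} W n` whenever it contains every `W n`, and is closed under isomorphism.  It contains
every power `V ^ α` with `1 ≤ α < ω₁`, for every choice of the sequences at limit stages. -/
inductive IsFubiniPower (V : Ultrafilter ℕ) : (X : Type) → Ultrafilter X → Prop
  | base : IsFubiniPower V ℕ V
  | lim (X : ℕ → Type) (W : ∀ n, Ultrafilter (X n)) (hW : ∀ n, IsFubiniPower V (X n) (W n)) :
      IsFubiniPower V (Σ n, X n) (fubiniLim V W)
  | iso (X Y : Type) (W : Ultrafilter X) (W' : Ultrafilter Y) (hW : IsFubiniPower V X W)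
      (h : Isomorphic (W : Filter X) (W' : Filter Y)) : IsFubiniPower V Y W'

/-- `B` is a flat-top front base for the Fubini power `U` of `V`: `U` is isomorphic to the
ultrafilter on `B` generated by the trees for the family with all members equal to `V`. -/
def IsFlatTopBase (V : Ultrafilter ℕ) {X : Type} (U : Ultrafilter X)
    (B : Set (Finset ℕ)) : Prop :=
  IsFlatTopFront B ∧ Isomorphic (U : Filter X) (treeFilter B fun _ => V)

end FubiniPower

namespace FubiniPower

/-! ### Initial segments -/

/-! Existence of a base is proved by induction on the generation of Fubini powers. The singletons
serve `V` itself. For a limit, `sumFront` puts `n` below the members of `B n` that lie above `n`;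
the other members are negligible because `V` is nonprincipal. A tree on the sum amounts to a
`V`-large set of `n` with a tree on `B n` for each, which is exactly membership in the Fubini limit
(`isUTree_sumFront`, `IsUTree.section_sumFront`, `IsFlatTopBase.fubiniLim`). Isomorphic copies are
handled by `Isomorphic.symm` and `Isomorphic.trans`.

The map is `τ a = max a`, finite-to-one on all finite sets. If `A ∈ V`, the nodes contained in `A`
form a tree, and all their maxima lie in `A`. Conversely, any tree `T` has a member `b` of `B` as a
maximal node, since the tree filter is proper. The predecessor `a = b \ {max b}` then has `V`-many
successors `a ∪ {n}` in `T`, and flatness puts them in `B` (`IsFlatTopFront.sdiff_max_union_mem`).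
So the maxima of `[T]` already form a set in `V`. As `[T] ⊆ T \ {∅}`, both bases follow. -/

theorem IsInitSeg.refl (a : Set ℕ) : IsInitSeg a a :=
  ⟨subset_rfl, fun _ hx _ _ _ => hx⟩

theorem IsInitSeg.trans {a b c : Set ℕ} (hab : IsInitSeg a b) (hbc : IsInitSeg b c) :
    IsInitSeg a c :=
  ⟨hab.1.trans hbc.1, fun x hx y hy hxy => hab.2 x (hbc.2 x hx y (hab.1 hy) hxy) y hy hxy⟩

theorem IsInitSeg.total {a b X : Set ℕ} (ha : IsInitSeg a X) (hb : IsInitSeg b X) :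
    IsInitSeg a b ∨ IsInitSeg b a := by
  by_cases h : a ⊆ b
  · exact .inl ⟨h, fun x hx y hy hxy => ha.2 x (hb.1 hx) y hy hxy⟩
  · obtain ⟨z, hza, hzb⟩ := Set.not_subset.1 h
    refine .inr ⟨fun y hy => ?_, fun x hx y hy hxy => hb.2 x (ha.1 hx) y hy hxy⟩
    rcases le_total y z with hyz | hzy
    · exact ha.2 y (hb.1 hy) z hza hyz
    · exact absurd (hb.2 z (ha.1 hza) y hy hzy) hzb

theorem isInitSeg_empty (X : Set ℕ) : IsInitSeg ((∅ : Finset ℕ) : Set ℕ) X := by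
  simp [IsInitSeg]

theorem isInitSeg_union {c Y : Set ℕ} (h : ∀ x ∈ c, ∀ y ∈ Y, x < y) : IsInitSeg c (c ∪ Y) := by
  refine ⟨subset_union_left, fun x hx y hy hxy => ?_⟩
  rcases hx with hx | hx
  · exact hx
  · exact absurd (h y hy x hx) (not_lt.2 hxy)

/-- Transfers questions about `sumFront B` to the single front `B n` by removing the least element.
-/
theorem isInitSeg_insert_iff {n : ℕ} {c b : Finset ℕ} (hc : ∀ x ∈ c, n < x)
    (hb : ∀ x ∈ b, n < x) :
    IsInitSeg (insert n c : Finset ℕ) (insert n b : Finset ℕ) ↔ IsInitSeg (c : Set ℕ) b := by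
  constructor
  · rintro ⟨h1, h2⟩
    refine ⟨fun x hx => ?_, fun x hx y hy hxy => ?_⟩
    · have h := h1 (show x ∈ ((insert n c : Finset ℕ) : Set ℕ) by
        simpa using Or.inr (Finset.mem_coe.1 hx))
      have := hc x hx
      simp only [Finset.coe_insert, Set.mem_insert_iff] at h
      rcases h with h | h
      · omega
      · exact h
    · have h := h2 x (by simpa using Or.inr (Finset.mem_coe.1 hx)) y
        (by simpa using Or.inr (Finset.mem_coe.1 hy)) hxy
      have := hb x hx
      simp only [Finset.coe_insert, Set.mem_insert_iff] at h
      rcases h with h | h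
      · omega
      · exact h
  · rintro ⟨h1, h2⟩
    simp only [Finset.coe_insert]
    refine ⟨Set.insert_subset_insert h1, ?_⟩
    rintro x (rfl | hx) y hy hxy
    · exact Set.mem_insert _ _
    · rcases hy with rfl | hy
      · have := hb x hx
        omega
      · exact Set.mem_insert_of_mem _ (h2 x hx y hy hxy)

theorem eq_insert_of_isInitSeg_insert {n : ℕ} {s b : Finset ℕ} (hb : ∀ x ∈ b, n < x)
    (h : IsInitSeg (s : Set ℕ) (insert n b : Finset ℕ)) (hs : s ≠ ∅) :
    s = insert n (s.erase n) ∧ ∀ x ∈ s.erase n, n < x := by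
  obtain ⟨y, hy⟩ := Finset.nonempty_iff_ne_empty.2 hs
  have hsub : ∀ x ∈ s, x = n ∨ x ∈ b := fun x hx => by simpa using h.1 hx
  have hn : n ∈ s := by
    refine h.2 n (by simp) y hy ?_
    rcases hsub y hy with rfl | h
    · exact le_rfl
    · exact (hb y h).le
  refine ⟨(Finset.insert_erase hn).symm, fun x hx => ?_⟩
  rw [Finset.mem_erase] at hx
  exact hb x ((hsub x hx.2).resolve_left hx.1)

theorem insert_inj_of_lt {n m : ℕ} {c b : Finset ℕ} (hc : ∀ x ∈ c, n < x) (hb : ∀ x ∈ b, m < x)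
    (h : insert n c = insert m b) : n = m ∧ c = b := by
  have hn : n = m := by
    have h1 : n ∈ insert m b := h ▸ Finset.mem_insert_self n c
    have h2 : m ∈ insert n c := h ▸ Finset.mem_insert_self m b
    rw [Finset.mem_insert] at h1 h2
    rcases h1 with h1 | h1
    · exact h1
    · rcases h2 with h2 | h2
      · exact h2.symm
      · have := hb n h1
        have := hc m h2
        omega
  subst hn
  refine ⟨rfl, ?_⟩
  rw [← Finset.erase_insert (fun hh => lt_irrefl _ (hc n hh)), h,
    Finset.erase_insert (fun hh => lt_irrefl _ (hb n hh))]

/-! ### Fronts -/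

section Front

variable {B : Set (Finset ℕ)}

theorem IsFront.eq_of_isInitSeg (hB : IsFront univ B) {a b : Finset ℕ} (ha : a ∈ B) (hb : b ∈ B)
    (h : IsInitSeg (a : Set ℕ) b) : a = b := by
  by_contra hne
  exact hB.antichain a ha b hb ⟨h, fun h => hne (Finset.coe_injective h)⟩

theorem subset_hat : B ⊆ hat B := fun b hb => ⟨b, hb, .refl _⟩

theorem hat_isTree : IsTree (hat B) := by
  rintro t ⟨b, hb, htb⟩ s hst
  exact ⟨b, hb, hst.trans htb⟩

/-- A node of a front may be extended to a member of the front inside any infinite end piece. -/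
theorem IsFront.exists_extension (hB : IsFront univ B) {c : Finset ℕ} (hc : c ∈ hat B)
    {Y : Set ℕ} (hY : Y.Infinite) (hcY : ∀ x ∈ c, ∀ y ∈ Y, x < y) :
    ∃ b ∈ B, IsInitSeg (c : Set ℕ) b ∧ ((b = c) ∨ IsInitSeg (b : Set ℕ) (c ∪ Y)) := by
  obtain ⟨b, hb, hbX, -⟩ := hB.exists_initSeg (c ∪ Y) (subset_univ _) (hY.mono subset_union_right)
  rcases (isInitSeg_union (c := (c : Set ℕ)) hcY).total hbX with h | h
  · exact ⟨b, hb, h, .inr hbX⟩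
  · obtain ⟨d, hd, hcd⟩ := hc
    have hbd := hB.eq_of_isInitSeg hb hd (h.trans hcd)
    subst hbd
    have hbc : b = c := Finset.coe_injective (h.1.antisymm hcd.1)
    exact ⟨b, hb, hcd, .inl hbc⟩

theorem IsFront.union_singleton_mem_hat (hB : IsFront univ B) {c : Finset ℕ}
    (hc : c ∈ hatMinus B) {n : ℕ} (hn : ∀ x ∈ c, x < n) : c ∪ {n} ∈ hat B := by
  -- Extend `c` into `[n, ∞)`. As `c ∉ B`, the member obtained is strictly longer, so its first new
  -- element is `n`.
  obtain ⟨b, hb, hcb, h⟩ := hB.exists_extension hc.1 (Set.Ici_infinite n)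
    (fun x hx y hy => (hn x hx).trans_le hy)
  rcases h with rfl | h
  · exact absurd hb hc.2
  have hne : ¬ (b ⊆ c) := fun hh =>
    hc.2 (Finset.Subset.antisymm hh (Finset.coe_subset.1 hcb.1) ▸ hb)
  obtain ⟨y, hyb, hyc⟩ := Finset.not_subset.1 hne
  have hny : n ≤ y := by
    rcases h.1 hyb with h | h
    · exact absurd h hyc
    · exact h
  have hnb : n ∈ (b : Set ℕ) := h.2 n (.inr (Set.self_mem_Ici)) y hyb hny
  refine ⟨b, hb, ?_, ?_⟩
  · intro x hx
    simp only [Finset.coe_union, Finset.coe_singleton, Set.union_singleton,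
      Set.mem_insert_iff] at hx
    rcases hx with rfl | hx
    · exact hnb
    · exact hcb.1 hx
  · intro x hx z hz hxz
    simp only [Finset.coe_union, Finset.coe_singleton, Set.union_singleton,
      Set.mem_insert_iff] at hz ⊢
    rcases hz with rfl | hz
    · rcases h.1 hx with h | h
      · exact .inr h
      · exact .inl (le_antisymm hxz h)
    · exact .inr (hcb.2 x hx z hz hxz)

theorem IsFront.nonempty (hB : IsFront univ B) : B.Nonempty := by
  obtain ⟨b, hb, -⟩ := hB.exists_initSeg univ subset_rfl infinite_univ
  exact ⟨b, hb⟩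

theorem IsFront.empty_mem_hat (hB : IsFront univ B) : ∅ ∈ hat B := by
  obtain ⟨b, hb⟩ := hB.nonempty
  exact ⟨b, hb, isInitSeg_empty _⟩

theorem IsFront.empty_notMem (hB : IsFront univ B) (h : B ≠ {∅}) : ∅ ∉ B := by
  intro h0
  refine h (Set.eq_singleton_iff_unique_mem.2 ⟨h0, fun b hb => ?_⟩)
  exact (hB.eq_of_isInitSeg h0 hb (isInitSeg_empty _)).symm

end Front

/-! ### Trees for a nonprincipal ultrafilter -/

section Trees

variable {B : Set (Finset ℕ)} {V : Ultrafilter ℕ}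

theorem Ioi_mem_of_le_cofinite (hV : (V : Filter ℕ) ≤ cofinite) (n : ℕ) : Set.Ioi n ∈ V := by
  apply hV
  rw [mem_cofinite, Set.compl_Ioi]
  exact Set.finite_Iic n

theorem setOf_forall_lt_mem (hV : (V : Filter ℕ) ≤ cofinite) (c : Finset ℕ) :
    {n | ∀ x ∈ c, x < n} ∈ V := by
  refine Filter.mem_of_superset (Ioi_mem_of_le_cofinite hV (c.sup id)) fun n hn x hx => ?_
  exact (Finset.le_sup (f := id) hx).trans_lt hn

theorem IsUTree.inter {W : Finset ℕ → Ultrafilter ℕ} {T T' : Set (Finset ℕ)}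
    (h : IsUTree B W T) (h' : IsUTree B W T') : IsUTree B W (T ∩ T') where
  subset_hat := inter_subset_left.trans h.subset_hat
  isTree t ht s hs := ⟨h.isTree t ht.1 s hs, h'.isTree t ht.2 s hs⟩
  empty_mem := ⟨h.empty_mem, h'.empty_mem⟩
  succ_mem c hc := Filter.inter_mem (h.succ_mem c ⟨hc.1.1, hc.2⟩) (h'.succ_mem c ⟨hc.1.2, hc.2⟩)

/-- The nodes which are contained in a given large set form a tree. -/
theorem IsFront.isUTree_subsets (hB : IsFront univ B) (hV : (V : Filter ℕ) ≤ cofinite)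
    {A : Set ℕ} (hA : A ∈ V) : IsUTree B (fun _ => V) {c | c ∈ hat B ∧ ∀ x ∈ c, x ∈ A} where
  subset_hat _ hc := hc.1
  isTree t ht s hs := ⟨hat_isTree t ht.1 s hs, fun x hx => ht.2 x (hs.1 hx)⟩
  empty_mem := ⟨hB.empty_mem_hat, by simp⟩
  succ_mem c hc := by
    filter_upwards [hA, setOf_forall_lt_mem hV c] with n hn hcn
    refine ⟨hB.union_singleton_mem_hat hc.2 hcn, fun x hx => ?_⟩
    rw [Finset.mem_union, Finset.mem_singleton] at hx
    rcases hx with hx | rfl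
    · exact hc.1.2 x hx
    · exact hn

/-- A node outside `B` has a successor in `T` beyond its maximum, so it is not maximal; a node in
`B` is maximal because `B` is an antichain. -/
theorem IsUTree.maxBranches_eq (hB : IsFront univ B) (hV : (V : Filter ℕ) ≤ cofinite)
    {T : Set (Finset ℕ)} (hT : IsUTree B (fun _ => V) T) : maxBranches T = T ∩ B := by
  ext t
  constructor
  · rintro ⟨ht, hmax⟩
    refine ⟨ht, ?_⟩
    by_contra htB
    obtain ⟨n, hn, htn⟩ := V.nonempty_of_mem
      (Filter.inter_mem (hT.succ_mem t ⟨ht, hT.subset_hat ht, htB⟩) (setOf_forall_lt_mem hV t))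
    have h := hmax _ hn (by
      rw [Finset.coe_union]
      exact isInitSeg_union fun x hx y hy => by
        rw [Finset.coe_singleton, Set.mem_singleton_iff] at hy
        exact hy ▸ htn x hx)
    have hnt : n ∈ t := h ▸ Finset.mem_union_right _ (Finset.mem_singleton_self n)
    exact lt_irrefl _ (htn n hnt)
  · rintro ⟨ht, htB⟩
    refine ⟨ht, fun s hs hts => ?_⟩
    obtain ⟨b, hb, hsb⟩ := hT.subset_hat hs
    obtain rfl := hB.eq_of_isInitSeg htB hb (hts.trans hsb)
    exact Finset.coe_injective (hsb.1.antisymm hts.1)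

/-- Trees are closed under intersection, so the sets `T ∩ B` form a base of the generated filter,
not merely a subbase. -/
theorem mem_treeFilter_iff (hB : IsFront univ B) (hV : (V : Filter ℕ) ≤ cofinite) {S : Set B} :
    S ∈ treeFilter B (fun _ => V) ↔
      ∃ T, IsUTree B (fun _ => V) T ∧ ∀ b : B, (b : Finset ℕ) ∈ T → b ∈ S := by
  constructor
  · intro h
    induction h with
    | basic h =>
      obtain ⟨T, hT, rfl⟩ := h
      refine ⟨T, hT, fun b hb => ?_⟩
      rw [Set.mem_ofPred_eq, hT.maxBranches_eq hB hV]
      exact ⟨hb, b.2⟩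
    | univ => exact ⟨_, hB.isUTree_subsets hV Filter.univ_mem, fun _ _ => mem_univ _⟩
    | superset _ hst ih =>
      obtain ⟨T, hT, h⟩ := ih
      exact ⟨T, hT, fun b hb => hst (h b hb)⟩
    | inter _ _ ih ih' =>
      obtain ⟨T, hT, h⟩ := ih
      obtain ⟨T', hT', h'⟩ := ih'
      exact ⟨T ∩ T', hT.inter hT', fun b hb => ⟨h b hb.1, h' b hb.2⟩⟩
  · rintro ⟨T, hT, h⟩
    refine Filter.GenerateSets.superset (.basic ⟨T, hT, rfl⟩) fun b hb => h b ?_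
    exact hb.1

end Trees

/-! ### Isomorphism -/

theorem Isomorphic.symm {X Y : Type} [Nonempty X] {F : Filter X} {G : Filter Y}
    (h : Isomorphic F G) : Isomorphic G F := by
  obtain ⟨f, ⟨A, hA, hinj⟩, rfl⟩ := h
  refine ⟨Function.invFunOn f A, ⟨f '' A, Filter.image_mem_map hA,
    Function.invFunOn_injOn_image f A⟩, ?_⟩
  rw [Filter.map_map]
  conv_rhs => rw [← Filter.map_id (f := F)]
  refine Filter.map_congr (Filter.mem_of_superset hA fun x hx => ?_)
  exact hinj.leftInvOn_invFunOn hx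

theorem Isomorphic.trans {X Y Z : Type} {F : Filter X} {G : Filter Y} {H : Filter Z}
    (h : Isomorphic F G) (h' : Isomorphic G H) : Isomorphic F H := by
  obtain ⟨f, ⟨A, hA, hinj⟩, rfl⟩ := h
  obtain ⟨g, ⟨A', hA', hinj'⟩, rfl⟩ := h'
  refine ⟨g ∘ f, ⟨A ∩ f ⁻¹' A', Filter.inter_mem hA hA', ?_⟩, Filter.map_map.symm⟩
  exact hinj'.comp (hinj.mono inter_subset_left) fun x hx => hx.2

/-! ### The front of singletons -/

theorem isFlatTopFront_singletons : IsFlatTopFront {b | b.card = 1} := by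
  refine ⟨⟨fun _ _ => subset_univ _, ?_, ?_⟩, ?_, .inl rfl⟩
  · rintro a ha b hb ⟨h, hne⟩
    have ha : a.card = 1 := ha
    have hb : b.card = 1 := hb
    exact hne (congrArg _ (Finset.eq_of_subset_of_card_le (Finset.coe_subset.1 h.1) (by omega)))
  · intro X _ hX
    obtain ⟨m, hm, hmin⟩ := WellFounded.has_min (wellFounded_lt (α := ℕ)) X hX.nonempty
    refine ⟨{m}, Finset.card_singleton m, ⟨by simpa using hm, ?_⟩, ?_⟩
    · intro x hx y hy hxy
      have := hmin x hx
      simp only [Finset.coe_singleton, Set.mem_singleton_iff] at hy ⊢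
      omega
    · intro h
      exact hX (h ▸ Finset.finite_toSet _)
  · intro h
    have h0 : (∅ : Finset ℕ) ∈ {b : Finset ℕ | b.card = 1} := h ▸ rfl
    simp at h0

theorem isFlatTopBase_singletons {V : Ultrafilter ℕ} (hV : (V : Filter ℕ) ≤ cofinite) :
    IsFlatTopBase V V {b | b.card = 1} := by
  have hB := isFlatTopFront_singletons
  refine ⟨hB, fun n => ⟨{n}, Finset.card_singleton n⟩, ⟨univ, Filter.univ_mem, ?_⟩, ?_⟩
  · intro n _ m _ h
    exact Finset.singleton_injective (congrArg Subtype.val h)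
  ext S
  rw [mem_treeFilter_iff hB.1 hV, Filter.mem_map]
  constructor
  · intro h
    refine ⟨_, hB.1.isUTree_subsets hV h, ?_⟩
    rintro ⟨b, hb⟩ hbT
    obtain ⟨n, rfl⟩ := Finset.card_eq_one.1 hb
    exact hbT.2 n (Finset.mem_singleton_self n)
  · rintro ⟨T, hT, h⟩
    filter_upwards [hT.succ_mem ∅ ⟨hT.empty_mem, hB.1.empty_mem_hat,
      hB.1.empty_notMem hB.2.1⟩] with n hn
    exact h _ (by simpa using hn)

/-! ### Sums of fronts -/

/-- The front whose members are `{n} ∪ b` with `b ∈ B n` and `n < min b`. -/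
def sumFront (B : ℕ → Set (Finset ℕ)) : Set (Finset ℕ) :=
  {d | ∃ n, ∃ b ∈ B n, (∀ x ∈ b, n < x) ∧ d = insert n b}

section Sum

variable {B : ℕ → Set (Finset ℕ)}

theorem insert_mem_sumFront {n : ℕ} {c : Finset ℕ} (hc : ∀ x ∈ c, n < x) :
    insert n c ∈ sumFront B ↔ c ∈ B n := by
  constructor
  · rintro ⟨m, b, hb, hmb, h⟩
    obtain ⟨rfl, rfl⟩ := insert_inj_of_lt hc hmb h
    exact hb
  · exact fun h => ⟨n, c, h, hc, rfl⟩

theorem isFront_sumFront (hB : ∀ n, IsFront univ (B n)) : IsFront univ (sumFront B) where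
  subset_base _ _ := subset_univ _
  antichain := by
    rintro _ ⟨n, a, ha, hna, rfl⟩ _ ⟨m, b, hb, hmb, rfl⟩ ⟨h, hne⟩
    obtain ⟨he, hlt⟩ := eq_insert_of_isInitSeg_insert hmb h (Finset.insert_ne_empty _ _)
    obtain ⟨rfl, -⟩ := insert_inj_of_lt hna hlt he
    rw [isInitSeg_insert_iff hna hmb] at h
    exact hne (by rw [(hB n).eq_of_isInitSeg ha hb h])
  exists_initSeg := by
    intro X _ hX
    -- The least element `n` of `X` selects the front `B n`, which is then applied to the rest of
    -- `X`.
    obtain ⟨n, hn, hmin⟩ := WellFounded.has_min (wellFounded_lt (α := ℕ)) X hX.nonempty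
    obtain ⟨b, hb, h, -⟩ := (hB n).exists_initSeg (X \ {n}) (subset_univ _)
      (hX.sdiff (Set.finite_singleton n))
    have hnb : ∀ x ∈ b, n < x := fun x hx => by
      have h1 := hmin x (h.1 hx).1
      have h2 : x ≠ n := (h.1 hx).2
      omega
    refine ⟨insert n b, ⟨n, b, hb, hnb, rfl⟩, ⟨?_, ?_⟩, fun h => hX (h ▸ Finset.finite_toSet _)⟩
    · rw [Finset.coe_insert]
      exact Set.insert_subset hn (h.1.trans sdiff_subset)
    · intro x hx y hy hxy
      rw [Finset.coe_insert] at hy ⊢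
      by_cases hxn : x = n
      · exact .inl hxn
      · rcases hy with rfl | hy
        · exact absurd (hmin x hx) (by omega)
        · exact .inr (h.2 x ⟨hx, hxn⟩ y hy hxy)

theorem insert_mem_hat_sumFront (hB : ∀ n, IsFront univ (B n)) {n : ℕ} {c : Finset ℕ}
    (hc : ∀ x ∈ c, n < x) : insert n c ∈ hat (sumFront B) ↔ c ∈ hat (B n) := by
  constructor
  · rintro ⟨_, ⟨m, b, hb, hmb, rfl⟩, h⟩
    obtain ⟨he, hlt⟩ := eq_insert_of_isInitSeg_insert hmb h (Finset.insert_ne_empty _ _)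
    obtain ⟨rfl, -⟩ := insert_inj_of_lt hc hlt he
    exact ⟨b, hb, (isInitSeg_insert_iff hc hmb).1 h⟩
  · intro h
    -- The new elements must also exceed `n`, which matters when `c` is empty.
    obtain ⟨b, hb, hcb, h⟩ := (hB n).exists_extension h (Set.Ioi_infinite (max n (c.sup id)))
      (fun x hx y hy => (Finset.le_sup (f := id) hx).trans_lt ((le_max_right _ _).trans_lt hy))
    have hnb : ∀ x ∈ b, n < x := by
      rcases h with rfl | h
      · exact hc
      · intro x hx
        rcases h.1 hx with h | h
        · exact hc x h
        · exact (le_max_left _ _).trans_lt h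
    exact ⟨_, ⟨n, b, hb, hnb, rfl⟩, (isInitSeg_insert_iff hc hnb).2 hcb⟩

theorem isUTree_sumFront {V : Ultrafilter ℕ} (hV : (V : Filter ℕ) ≤ cofinite)
    (hB : ∀ n, IsFront univ (B n)) {A : Set ℕ} (hA : A ∈ V) {T : ℕ → Set (Finset ℕ)}
    (hT : ∀ n ∈ A, IsUTree (B n) (fun _ => V) (T n)) :
    IsUTree (sumFront B) (fun _ => V)
      {d | d = ∅ ∨ ∃ n ∈ A, ∃ c ∈ T n, (∀ x ∈ c, n < x) ∧ d = insert n c} where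
  subset_hat := by
    rintro _ (rfl | ⟨n, hn, c, hc, hnc, rfl⟩)
    · exact (isFront_sumFront hB).empty_mem_hat
    · exact (insert_mem_hat_sumFront hB hnc).2 ((hT n hn).subset_hat hc)
  isTree := by
    rintro _ (rfl | ⟨n, hn, c, hc, hnc, rfl⟩) s hs
    · left
      simpa using hs.1
    · rcases eq_or_ne s ∅ with rfl | hne
      · exact .inl rfl
      · obtain ⟨he, hlt⟩ := eq_insert_of_isInitSeg_insert hnc hs hne
        rw [he, isInitSeg_insert_iff hlt hnc] at hs
        exact .inr ⟨n, hn, s.erase n, (hT n hn).isTree c hc _ hs, hlt, he⟩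
  empty_mem := .inl rfl
  succ_mem := by
    rintro _ ⟨rfl | ⟨n, hn, c, hc, hnc, rfl⟩, hmem⟩
    · filter_upwards [hA] with n hn
      exact .inr ⟨n, hn, ∅, (hT n hn).empty_mem, by simp, by simp⟩
    · have hcB : c ∉ B n := fun h => hmem.2 ((insert_mem_sumFront hnc).2 h)
      filter_upwards [(hT n hn).succ_mem c ⟨hc, (hT n hn).subset_hat hc, hcB⟩,
        Ioi_mem_of_le_cofinite hV n] with m hm hnm
      refine .inr ⟨n, hn, c ∪ {m}, hm, fun x hx => ?_, Finset.insert_union _ _ _⟩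
      rw [Finset.mem_union, Finset.mem_singleton] at hx
      rcases hx with hx | rfl
      · exact hnc x hx
      · exact hnm

theorem IsUTree.section_sumFront {V : Ultrafilter ℕ} (hV : (V : Filter ℕ) ≤ cofinite)
    (hB : ∀ n, IsFront univ (B n)) {T : Set (Finset ℕ)}
    (hT : IsUTree (sumFront B) (fun _ => V) T) {n : ℕ} (hn : {n} ∈ T) :
    IsUTree (B n) (fun _ => V) {c | (∀ x ∈ c, n < x) ∧ insert n c ∈ T} where
  subset_hat c hc := (insert_mem_hat_sumFront hB hc.1).1 (hT.subset_hat hc.2)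
  isTree t ht s hs := by
    have hlt : ∀ x ∈ s, n < x := fun x hx => ht.1 x (hs.1 hx)
    exact ⟨hlt, hT.isTree _ ht.2 _ ((isInitSeg_insert_iff hlt ht.1).2 hs)⟩
  empty_mem := ⟨by simp, by simpa using hn⟩
  succ_mem c hc := by
    filter_upwards [Ioi_mem_of_le_cofinite hV n, hT.succ_mem _ ⟨hc.1.2, hT.subset_hat hc.1.2,
      fun h => hc.2.2 ((insert_mem_sumFront hc.1.1).1 h)⟩] with m hnm hm
    refine ⟨fun x hx => ?_, by rwa [← Finset.insert_union]⟩
    rw [Finset.mem_union, Finset.mem_singleton] at hx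
    rcases hx with hx | rfl
    · exact hc.1.1 x hx
    · exact hnm

end Sum

/-! ### Flat tops -/

theorem erase_max_lt {b : Finset ℕ} {x : ℕ} (hx : x ∈ b \ {b.sup id}) : x < b.sup id := by
  rw [Finset.mem_sdiff, Finset.mem_singleton] at hx
  exact lt_of_le_of_ne (Finset.le_sup (f := id) hx.1) hx.2

theorem sup_id_mem {b : Finset ℕ} (hb : b.Nonempty) : b.sup id ∈ b := by
  obtain ⟨x, hx, h⟩ := Finset.exists_mem_eq_sup b hb id
  exact h ▸ hx

theorem sdiff_max_isInitSeg (b : Finset ℕ) :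
    IsInitSeg ((b \ {b.sup id} : Finset ℕ) : Set ℕ) b := by
  refine ⟨Finset.coe_subset.2 Finset.sdiff_subset, fun x hx y hy hxy => ?_⟩
  have := erase_max_lt hy
  rw [Finset.mem_coe] at hx ⊢
  rw [Finset.mem_sdiff, Finset.mem_singleton]
  exact ⟨hx, by omega⟩

/-- The one-step extensions of the predecessor of a member of a flat-top front belong to the
front. -/
theorem IsFlatTopFront.sdiff_max_union_mem {B : Set (Finset ℕ)} (hB : IsFlatTopFront B)
    {b : Finset ℕ} (hb : b ∈ B) {n : ℕ} (hn : ∀ x ∈ b \ {b.sup id}, x < n) :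
    b \ {b.sup id} ∪ {n} ∈ B := by
  obtain ⟨hF, hne, h | ⟨hcard, h⟩⟩ := hB
  · subst h
    obtain ⟨m, rfl⟩ := Finset.card_eq_one.1 hb
    simp
  · have hnonempty : (b \ {b.sup id}).Nonempty := by
      rw [← Finset.card_pos]
      have h1 := Finset.le_card_sdiff {b.sup id} b
      have h2 := hcard b hb
      rw [Finset.card_singleton] at h1
      omega
    have hmem : ({n} : Finset ℕ) ∈ {d : Finset ℕ | ∃ m : ℕ, (b \ {b.sup id}).sup id < m ∧
        d = {m}} := ⟨n, hn _ (sup_id_mem hnonempty), rfl⟩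
    rw [← h b hb _ rfl] at hmem
    obtain ⟨c, hc, hac, hnc⟩ := hmem
    rw [hnc, Finset.union_sdiff_of_subset (Finset.coe_subset.1 hac.1.1)]
    exact hc

/-- If a member `c` properly extends the predecessor `a`, with next element `m`, then `a ∪ {m}` is
an initial segment of `c` that lies in `B`; the antichain property makes them equal. -/
theorem IsFront.isFlatTopFront {B : Set (Finset ℕ)} (hF : IsFront univ B)
    (hcard : ∀ b ∈ B, 2 ≤ b.card)
    (h : ∀ b ∈ B, ∀ n, (∀ x ∈ b \ {b.sup id}, x < n) → b \ {b.sup id} ∪ {n} ∈ B) :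
    IsFlatTopFront B := by
  refine ⟨hF, ?_, .inr ⟨hcard, ?_⟩⟩
  · rintro rfl
    simpa using hcard ∅ rfl
  rintro b hb a rfl
  have hnonempty : (b \ {b.sup id}).Nonempty := by
    rw [← Finset.card_pos]
    have h1 := Finset.le_card_sdiff {b.sup id} b
    have h2 := hcard b hb
    rw [Finset.card_singleton] at h1
    omega
  have hsup := sup_id_mem hnonempty
  ext d
  constructor
  · rintro ⟨c, hc, ⟨hac, hne⟩, rfl⟩
    have hex : ∃ m, m ∈ c \ (b \ {b.sup id}) := by
      by_contra! hh
      refine hne (hac.1.antisymm fun x hx => ?_)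
      by_contra hx'
      exact hh x (Finset.mem_sdiff.2 ⟨hx, hx'⟩)
    set m := Nat.find hex with hm
    have hmem : m ∈ c \ (b \ {b.sup id}) := Nat.find_spec hex
    have hlt : ∀ x ∈ b \ {b.sup id}, x < m := by
      intro x hx
      by_contra! hmx
      exact (Finset.mem_sdiff.1 hmem).2 (hac.2 m (Finset.mem_sdiff.1 hmem).1 x hx hmx)
    have hinit : IsInitSeg ((b \ {b.sup id} ∪ {m} : Finset ℕ) : Set ℕ) c := by
      constructor
      · intro x hx
        rw [Finset.mem_coe, Finset.mem_union, Finset.mem_singleton] at hx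
        rcases hx with hx | rfl
        · exact hac.1 hx
        · exact (Finset.mem_sdiff.1 hmem).1
      · intro x hx y hy hxy
        rw [Finset.mem_coe, Finset.mem_union, Finset.mem_singleton] at hy ⊢
        by_cases hxa : x ∈ b \ {b.sup id}
        · exact .inl hxa
        · have h1 : m ≤ x := Nat.find_min' hex (Finset.mem_sdiff.2 ⟨hx, hxa⟩)
          rcases hy with hy | rfl
          · exact .inl (hac.2 x hx y hy hxy)
          · exact .inr (le_antisymm hxy h1)
    refine ⟨m, hlt _ hsup, ?_⟩
    rw [← hF.eq_of_isInitSeg (h b hb m hlt) hc hinit, Finset.union_sdiff_left]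
    exact Finset.sdiff_eq_self_of_disjoint
      (Finset.disjoint_singleton_left.2 (Finset.mem_sdiff.1 hmem).2)
  · rintro ⟨n, hn, rfl⟩
    have hlt : ∀ x ∈ b \ {b.sup id}, x < n :=
      fun x hx => (Finset.le_sup (f := id) hx).trans_lt hn
    have hna : n ∉ b \ {b.sup id} := fun hh => lt_irrefl _ (hlt n hh)
    refine ⟨_, h b hb n hlt, ⟨?_, ?_⟩, ?_⟩
    · rw [Finset.coe_union]
      refine isInitSeg_union fun x hx y hy => ?_
      rw [Finset.coe_singleton, Set.mem_singleton_iff] at hy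
      exact hy ▸ hlt x hx
    · intro hh
      exact hna (Finset.coe_injective hh ▸ by simp)
    · rw [Finset.union_sdiff_left]
      exact (Finset.sdiff_eq_self_of_disjoint (Finset.disjoint_singleton_left.2 hna)).symm

theorem isFlatTopFront_sumFront {B : ℕ → Set (Finset ℕ)} (hB : ∀ n, IsFlatTopFront (B n)) :
    IsFlatTopFront (sumFront B) := by
  have hne : ∀ n, ∀ b ∈ B n, b.Nonempty := by
    intro n b hb
    rw [Finset.nonempty_iff_ne_empty]
    rintro rfl
    exact (hB n).1.empty_notMem (hB n).2.1 hb
  refine (isFront_sumFront fun n => (hB n).1).isFlatTopFront ?_ ?_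
  · rintro _ ⟨n, b, hb, hnb, rfl⟩
    rw [Finset.card_insert_of_notMem fun h => lt_irrefl _ (hnb n h)]
    have := Finset.card_pos.2 (hne n b hb)
    omega
  · rintro _ ⟨n, b, hb, hnb, rfl⟩ m hm
    have hnsup : n < b.sup id := hnb _ (sup_id_mem (hne n b hb))
    have hsup : (insert n b).sup id = b.sup id := by
      rw [Finset.sup_insert]
      exact sup_eq_right.2 hnsup.le
    have heq : insert n b \ {b.sup id} = insert n (b \ {b.sup id}) :=
      Finset.insert_sdiff_of_notMem _ (by simpa using hnsup.ne)
    rw [hsup, heq] at hm ⊢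
    have hnm : n < m := hm n (Finset.mem_insert_self _ _)
    rw [Finset.insert_union, insert_mem_sumFront]
    · exact (hB n).sdiff_max_union_mem hb fun x hx => hm x (Finset.mem_insert_of_mem hx)
    · intro x hx
      rw [Finset.mem_union, Finset.mem_singleton] at hx
      rcases hx with hx | rfl
      · exact hnb x (Finset.sdiff_subset hx)
      · exact hnm

/-! ### Flat-top front bases -/

theorem IsFlatTopBase.fubiniLim {V : Ultrafilter ℕ} (hV : (V : Filter ℕ) ≤ cofinite)
    {X : ℕ → Type} {W : ∀ n, Ultrafilter (X n)} {B : ℕ → Set (Finset ℕ)}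
    (h : ∀ n, IsFlatTopBase V (W n) (B n)) :
    IsFlatTopBase V (fubiniLim V W) (sumFront B) := by
  classical
  have hF : ∀ n, IsFront univ (B n) := fun n => (h n).1.1
  have hS := isFlatTopFront_sumFront fun n => (h n).1
  refine ⟨hS, ?_⟩
  obtain ⟨b₀, hb₀⟩ := hS.1.nonempty
  choose f hf using fun n => (h n).2
  choose A hA hinj using fun n => (hf n).1
  have hmap : ∀ n, Filter.map (f n) (W n) = treeFilter (B n) fun _ => V := fun n => (hf n).2
  -- The default `b₀` is used only where `f n x` does not lie above `n`; by `hlarge` this is a `W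
  -- n`-null set for each `n`.
  let F : (Σ n, X n) → sumFront B := fun p =>
    if hp : ∀ x ∈ (f p.1 p.2 : Finset ℕ), p.1 < x then
      ⟨insert p.1 (f p.1 p.2 : Finset ℕ), (insert_mem_sumFront hp).2 (f p.1 p.2).2⟩
    else ⟨b₀, hb₀⟩
  have hFval : ∀ n x, (∀ y ∈ (f n x : Finset ℕ), n < y) →
      (F ⟨n, x⟩ : Finset ℕ) = insert n (f n x : Finset ℕ) := by
    intro n x hx
    simp only [F]
    rw [dif_pos hx]
  have hlarge : ∀ n, {x | ∀ y ∈ (f n x : Finset ℕ), n < y} ∈ W n := by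
    intro n
    have h1 : {b : B n | ∀ y ∈ (b : Finset ℕ), n < y} ∈ treeFilter (B n) fun _ => V :=
      (mem_treeFilter_iff (hF n) hV).2
        ⟨_, (hF n).isUTree_subsets hV (Ioi_mem_of_le_cofinite hV n), fun b hb => hb.2⟩
    rw [← hmap] at h1
    exact h1
  refine ⟨F, ⟨{p | p.2 ∈ A p.1 ∧ ∀ y ∈ (f p.1 p.2 : Finset ℕ), p.1 < y}, ?_, ?_⟩, ?_⟩
  · refine (mem_fubiniLim V W _).2 (Filter.univ_mem' fun n => ?_)
    exact Filter.inter_mem (hA n) (hlarge n)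
  · rintro ⟨n, x⟩ ⟨hx, hnx⟩ ⟨m, y⟩ ⟨hy, hmy⟩ he
    have he' := congrArg Subtype.val he
    rw [hFval n x hnx, hFval m y hmy] at he'
    obtain ⟨rfl, hxy⟩ := insert_inj_of_lt hnx hmy he'
    exact congrArg (Sigma.mk n) (hinj n hx hy (Subtype.ext hxy))
  ext S
  rw [mem_treeFilter_iff hS.1 hV, Filter.mem_map]
  -- Largeness of each section of `F ⁻¹' S` is read off in `B n` through `f n`, where it is
  -- witnessed by a tree.
  have key : ∀ n, {x | F ⟨n, x⟩ ∈ S} ∈ W n ↔ ∃ T, IsUTree (B n) (fun _ => V) T ∧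
      ∀ b : B n, (b : Finset ℕ) ∈ T →
        (∀ x ∈ (b : Finset ℕ), n < x) ∧ insert n (b : Finset ℕ) ∈ Subtype.val '' S := by
    intro n
    have h1 := mem_treeFilter_iff (S := {b : B n | (∀ x ∈ (b : Finset ℕ), n < x) ∧
      insert n (b : Finset ℕ) ∈ Subtype.val '' S}) (hF n) hV
    rw [← hmap] at h1
    refine Iff.trans ?_ h1
    refine Filter.congr_sets (Filter.mem_of_superset (hlarge n) fun x hx => ?_)
    have hx' : ∀ y ∈ (f n x : Finset ℕ), n < y := hx
    constructor
    · exact fun h => ⟨hx', F ⟨n, x⟩, h, hFval n x hx'⟩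
    · rintro ⟨-, d, hd, he⟩
      rw [← hFval n x hx'] at he
      have he' : d = F ⟨n, x⟩ := Subtype.ext he
      change F ⟨n, x⟩ ∈ S
      exact he' ▸ hd
  have hiff : F ⁻¹' S ∈ (FubiniPower.fubiniLim V W : Filter (Σ n, X n)) ↔
      {n | {x | F ⟨n, x⟩ ∈ S} ∈ W n} ∈ V := mem_fubiniLim V W _
  rw [hiff]
  constructor
  · intro hmem
    -- The implication is kept inside the existential so that a tree can be chosen for every `n`,
    -- with a dummy value off the large set.
    have hex : ∀ n, ∃ T, {x | F ⟨n, x⟩ ∈ S} ∈ W n → IsUTree (B n) (fun _ => V) T ∧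
        ∀ b : B n, (b : Finset ℕ) ∈ T →
          (∀ x ∈ (b : Finset ℕ), n < x) ∧ insert n (b : Finset ℕ) ∈ Subtype.val '' S := by
      intro n
      by_cases hn : {x | F ⟨n, x⟩ ∈ S} ∈ W n
      · obtain ⟨T, hT⟩ := (key n).1 hn
        exact ⟨T, fun _ => hT⟩
      · exact ⟨∅, fun h => absurd h hn⟩
    choose T hT using hex
    refine ⟨_, isUTree_sumFront hV hF hmem fun n hn => (hT n hn).1, ?_⟩
    rintro ⟨d, hd⟩ (rfl | ⟨n, hn, c, hc, hnc, rfl⟩)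
    · exact absurd hd (hS.1.empty_notMem hS.2.1)
    · obtain ⟨-, e, he, hec⟩ := (hT n hn).2 ⟨c, (insert_mem_sumFront hnc).1 hd⟩ hc
      exact (Subtype.ext hec : e = ⟨insert n c, hd⟩) ▸ he
  · rintro ⟨T, hT, hTS⟩
    filter_upwards [hT.succ_mem ∅ ⟨hT.empty_mem, hS.1.empty_mem_hat,
      hS.1.empty_notMem hS.2.1⟩] with n hn
    refine (key n).2 ⟨_, hT.section_sumFront hV hF (by simpa using hn), ?_⟩
    rintro ⟨b, hb⟩ ⟨hnb, hbT⟩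
    exact ⟨hnb, ⟨insert n b, (insert_mem_sumFront hnb).2 hb⟩, hTS _ hbT, rfl⟩

theorem IsFubiniPower.exists_isFlatTopBase {V : Ultrafilter ℕ} (hV : (V : Filter ℕ) ≤ cofinite)
    {X : Type} {U : Ultrafilter X} (hU : IsFubiniPower V X U) : ∃ B, IsFlatTopBase V U B := by
  induction hU with
  | base => exact ⟨_, isFlatTopBase_singletons hV⟩
  | lim X W _ ih =>
    choose B hB using ih
    exact ⟨_, IsFlatTopBase.fubiniLim hV hB⟩
  | iso X Y W W' _ h ih =>
    obtain ⟨B, hB, hWB⟩ := ih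
    have : Nonempty X := W.neBot.nonempty
    exact ⟨B, hB, h.symm.trans hWB⟩

/-- The tree filter is an image of the ultrafilter `U`, hence proper, so its generators are
nonempty. -/
theorem IsFlatTopBase.exists_mem_maxBranches {V : Ultrafilter ℕ} {X : Type} {U : Ultrafilter X}
    {B : Set (Finset ℕ)} (h : IsFlatTopBase V U B) {T : Set (Finset ℕ)}
    (hT : IsUTree B (fun _ => V) T) : ∃ b ∈ B, b ∈ maxBranches T := by
  obtain ⟨-, f, -, hf⟩ := h
  have hne : (treeFilter B fun _ => V).NeBot := hf ▸ inferInstance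
  obtain ⟨b, hb⟩ := hne.nonempty_of_mem
    (show {b : B | (b : Finset ℕ) ∈ maxBranches T} ∈ treeFilter B fun _ => V from
      .basic ⟨T, hT, rfl⟩)
  exact ⟨b, b.2, hb⟩

theorem finite_setOf_sup_id_eq (k : ℕ) : {a : Finset ℕ | a.sup id = k}.Finite := by
  refine (Finset.finite_toSet (Finset.range (k + 1)).powerset).subset fun a ha => ?_
  rw [Finset.mem_coe, Finset.mem_powerset]
  intro x hx
  have h1 : x ≤ a.sup id := Finset.le_sup (f := id) hx
  have h2 : a.sup id = k := ha
  rw [Finset.mem_range]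
  omega

theorem sup_union_singleton_of_forall_lt {c : Finset ℕ} {n : ℕ} (h : ∀ x ∈ c, x < n) :
    (c ∪ {n}).sup id = n := by
  rw [Finset.sup_union, Finset.sup_singleton]
  exact sup_eq_right.2 (Finset.sup_le fun x hx => (h x hx).le)

end FubiniPower

theorem corollary5p2 (V : Ultrafilter ℕ) (hV : FubiniPower.IsSelective V)
    (X : Type) (U : Ultrafilter X) (hU : FubiniPower.IsFubiniPower V X U) :
    (∃ B : Set (Finset ℕ), FubiniPower.IsFlatTopBase V U B) ∧
    ∀ B : Set (Finset ℕ), FubiniPower.IsFlatTopBase V U B →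
      ∃ τ : Finset ℕ → ℕ,
        (∀ k : ℕ, {a | a ∈ FubiniPower.hat B ∧ a ≠ ∅ ∧ τ a = k}.Finite) ∧
        (V : Filter ℕ).HasBasis (fun T => FubiniPower.IsUTree B (fun _ => V) T)
          (fun T => τ '' (T \ {∅})) ∧
        (V : Filter ℕ).HasBasis (fun T => FubiniPower.IsUTree B (fun _ => V) T)
          (fun T => τ '' FubiniPower.maxBranches T) := by
  refine ⟨hU.exists_isFlatTopBase hV.1, fun B hB => ?_⟩
  have hF := hB.1.1
  have h0 := hF.empty_notMem hB.1.2.1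
  have hsub : ∀ T, FubiniPower.IsUTree B (fun _ => V) T →
      FubiniPower.maxBranches T ⊆ T \ {∅} := by
    intro T hT
    rw [hT.maxBranches_eq hF hV.1]
    rintro t ⟨ht, htB⟩
    exact ⟨ht, fun h => h0 (Set.mem_singleton_iff.1 h ▸ htB)⟩
  have hto : ∀ A ∈ V, ∃ T, FubiniPower.IsUTree B (fun _ => V) T ∧
      (fun a : Finset ℕ => a.sup id) '' (T \ {∅}) ⊆ A := by
    intro A hA
    refine ⟨_, hF.isUTree_subsets hV.1 hA, ?_⟩
    rintro _ ⟨a, ⟨ha, hne⟩, rfl⟩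
    exact ha.2 _ (FubiniPower.sup_id_mem (Finset.nonempty_iff_ne_empty.2 hne))
  -- One predecessor suffices: the successors in `T` of `b \ {max b}` alone realise `V`-many maxima.
  have hfrom : ∀ T, FubiniPower.IsUTree B (fun _ => V) T →
      (fun a : Finset ℕ => a.sup id) '' FubiniPower.maxBranches T ∈ V := by
    intro T hT
    obtain ⟨b, hb, hbT⟩ := hB.exists_mem_maxBranches hT
    have hpred := FubiniPower.sdiff_max_isInitSeg b
    have hbne : b.Nonempty := Finset.nonempty_iff_ne_empty.2 fun h => h0 (h ▸ hb)
    -- The branching condition applies only to nodes outside `B`.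
    have hnot : b \ {b.sup id} ∉ B := by
      intro h
      have h1 := FubiniPower.sup_id_mem hbne
      have h2 : b.sup id ∈ b \ {b.sup id} := (hF.eq_of_isInitSeg h hb hpred).symm ▸ h1
      simp at h2
    filter_upwards [hT.succ_mem _ ⟨hT.isTree b hbT.1 _ hpred, ⟨b, hb, hpred⟩, hnot⟩,
      FubiniPower.setOf_forall_lt_mem hV.1 (b \ {b.sup id})] with n hn hlt
    refine ⟨b \ {b.sup id} ∪ {n}, ?_, FubiniPower.sup_union_singleton_of_forall_lt hlt⟩
    rw [hT.maxBranches_eq hF hV.1]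
    exact ⟨hn, hB.1.sdiff_max_union_mem hb hlt⟩
  refine ⟨fun a => a.sup id, fun k => (FubiniPower.finite_setOf_sup_id_eq k).subset
    fun a ha => ha.2.2, ⟨fun A => ⟨hto A, ?_⟩⟩, ⟨fun A => ⟨fun hA => ?_, ?_⟩⟩⟩
  · rintro ⟨T, hT, h⟩
    exact Filter.mem_of_superset (hfrom T hT) ((Set.image_mono (hsub T hT)).trans h)
  · obtain ⟨T, hT, h⟩ := hto A hA
    exact ⟨T, hT, (Set.image_mono (hsub T hT)).trans h⟩
  · rintro ⟨T, hT, h⟩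
    exact Filter.mem_of_superset (hfrom T hT) h
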